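/- Let $N\ge 1$, let $\Omega\subset\mathbb R^N$ be open, and let $\alpha>0$, $1<s<\infty$, $1\le q<\infty$. For a measurable function $f$ on $\mathbb R^N$ let $f^*(t)=\inf\{r>0:|\{|f|>r\}|\le t\}$ be its decreasing rearrangement, $f^{**}(t)=\frac1t\int_0^t f^*(\tau)\,d\tau$, and $$\|f\|_{s,q}=\Big(\int_0^\infty t^{q/s}\,(f^{**}(t))^q\,\frac{dt}{t}\Big)^{1/q},$$ and let $L^{s,q}(\mathbb R^N)$ be the Lorentz space of those $f$ with $\|f\|_{s,q}<\infty$. Let $G_\alpha$ be the Bessel kernel of order $\alpha$ in $\mathbb R^N$ (the function with Fourier transform $(1+|\xi|^2)^{-\alpha/2}$), let $L^{\alpha,s,q}(\mathbb R^N)=\{G_\alpha*f: f\in L^{s,q}(\mathbb R^N)\}$ with norm $\|G_\alpha*f\|_{\alpha,s,q}=\|f\|_{s,q}$, and for $E\subset\mathbb R^N$ let $$C_{\alpha,s,q}(E)=\inf\{\|f\|_{s,q}: f\in L^{s,q}(\mathbb R^N),\ f\ge 0,\ G_\alpha*f\ge 1\text{ on }E\}.$$ Let $\mu$ be a positive Radon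 measure on $\Omega$ that is absolutely continuous with respect to $C_{\alpha,s,q}$, that is, $\mu(E)=0$ for every Borel set $E\subset\Omega$ with $C_{\alpha,s,q}(E)=0$. Then there is a nondecreasing sequence $(\mu_n)$ of bounded positive Radon measures on $\Omega$, each with compact support in $\Omega$ and each (extended by $0$ to $\mathbb R^N$) belonging to the dual of $L^{\alpha,s,q}(\mathbb R^N)$, in the sense that every $G_\alpha*f$ with $f\in L^{s,q}(\mathbb R^N)$ is $\mu_n$-a.e. well defined and $\mu_n$-integrable, and there is a constant $c_n$ with $\left|\int G_\alpha*f\,d\mu_n\right|\le c_n\|f\|_{s,q}$ for all $f\in L^{s,q}(\mathbb R^N)$, such that $\mu_n\to\mu$ weakly in the sense of measures: $$\int_\Omega\varphi\,d\mu_n\to\int_\Omega\varphi\,d\mu\qquad\text{for every }\varphi\in C_c(\Omega).$$ If moreover $\mu$ is bounded, then the same sequence converges to $\mu$ in the narrow topology: $\int_\Omega\varphi\,d\mu_n\to\int_\Omega\varphi\,d\mu$ for every bounded continuous function $\varphi$ on $\Omega$. -/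

import Mathlib

open MeasureTheory Set Filter Topology
open scoped ENNReal NNReal BoundedContinuousFunction

noncomputable section

/-- The decreasing rearrangement `f* (t) = inf {r : |{x : |f x| > r}| ≤ t}` of a function on a
measure space. -/
def decreasingRearrangement {X : Type*} [MeasurableSpace X] (ν : Measure X) (f : X → ℝ) (t : ℝ) :
    ℝ≥0∞ :=
  sInf {r : ℝ≥0∞ | ν {x | r < ‖f x‖ₑ} ≤ ENNReal.ofReal t}

/-- The averaged rearrangement `f** (t) = (1 / t) ∫ τ in 0..t, f* (τ)`, for `t > 0`. -/
def averagedRearrangement {X : Type*} [MeasurableSpace X] (ν : Measure X) (f : X → ℝ) (t : ℝ) :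
    ℝ≥0∞ :=
  (ENNReal.ofReal t)⁻¹ * ∫⁻ τ in Ioc (0 : ℝ) t, decreasingRearrangement ν f τ

/-- The norm of the Lorentz space `L^{s,q}`, for `q < ∞`:
`(∫ t in 0..∞, t ^ (q / s) * f** (t) ^ q dt / t) ^ (1 / q)`. -/
def lorentzNorm {X : Type*} [MeasurableSpace X] (s q : ℝ) (ν : Measure X) (f : X → ℝ) : ℝ≥0∞ :=
  (∫⁻ t in Ioi (0 : ℝ), ENNReal.ofReal (t ^ (q / s - 1)) * averagedRearrangement ν f t ^ q)
    ^ (1 / q)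

/-- Membership in the Lorentz space `L^{s,q}`, for `q < ∞`. -/
def MemLorentz {X : Type*} [MeasurableSpace X] (s q : ℝ) (ν : Measure X) (f : X → ℝ) : Prop :=
  AEStronglyMeasurable f ν ∧ lorentzNorm s q ν f < ∞

/-- The Bessel kernel `G_α` of order `α > 0` on `ℝ^N`, the kernel of `(1 - Δ)^{-α/2}` (its Fourier
transform is `(1 + |ξ|²)^{-α/2}`), as the integral of heat kernels
`Γ(α/2)⁻¹ ∫ t in 0..∞, t^{α/2-1} e^{-t} (4πt)^{-N/2} e^{-|x|²/(4t)} dt`.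
Its value at `0` is `∞` when `α ≤ N`. -/
def besselKernel (N : ℕ) (α : ℝ) (x : EuclideanSpace ℝ (Fin N)) : ℝ≥0∞ :=
  ENNReal.ofReal (Real.Gamma (α / 2))⁻¹ *
    ∫⁻ t in Ioi (0 : ℝ), ENNReal.ofReal (t ^ (α / 2 - 1) * Real.exp (-t) *
      ((4 * Real.pi * t) ^ (-(N : ℝ) / 2) * Real.exp (-‖x‖ ^ 2 / (4 * t))))

/-- The Bessel potential `G_α * f` of a nonnegative function, with values in `[0, ∞]`. -/
def besselPotentialNonneg {N : ℕ} (α : ℝ) (f : EuclideanSpace ℝ (Fin N) → ℝ)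
    (x : EuclideanSpace ℝ (Fin N)) : ℝ≥0∞ :=
  ∫⁻ y, besselKernel N α (x - y) * ENNReal.ofReal (f y)

/-- The Bessel potential `G_α * f` of a real-valued function, at the points where the defining
integral converges absolutely. -/
def besselPotential {N : ℕ} (α : ℝ) (f : EuclideanSpace ℝ (Fin N) → ℝ)
    (x : EuclideanSpace ℝ (Fin N)) : ℝ :=
  ∫ y, (besselKernel N α (x - y)).toReal * f y

/-- The Lorentz–Bessel capacity
`C_{α,s,q}(E) = inf {‖f‖_{s,q} : f ∈ L^{s,q}(ℝ^N), f ≥ 0, G_α * f ≥ 1 on E}`. -/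
def besselLorentzCapacity {N : ℕ} (α s q : ℝ) (E : Set (EuclideanSpace ℝ (Fin N))) : ℝ≥0∞ :=
  sInf {c : ℝ≥0∞ | ∃ f : EuclideanSpace ℝ (Fin N) → ℝ, MemLorentz s q volume f ∧ (∀ y, 0 ≤ f y) ∧
    (∀ x ∈ E, 1 ≤ besselPotentialNonneg α f x) ∧ c = lorentzNorm s q volume f}

/-- A positive measure on `Ω ⊆ ℝ^N` is absolutely continuous with respect to `C_{α,s,q}` if it
vanishes on the Borel subsets of `Ω` of zero capacity. -/
def AbsolutelyContinuousCapacity {N : ℕ} (α s q : ℝ) {Ω : Set (EuclideanSpace ℝ (Fin N))}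
    (μ : Measure Ω) : Prop :=
  ∀ E : Set Ω, MeasurableSet E → besselLorentzCapacity α s q (Subtype.val '' E) = 0 → μ E = 0

/-- A positive measure `σ` on `ℝ^N` belongs to the dual of `L^{α,s,q}(ℝ^N)`, the space of the
functions `φ = G_α * f` with `f ∈ L^{s,q}(ℝ^N)`, normed by `‖φ‖_{α,s,q} = ‖f‖_{s,q}`: every such `φ`
is well defined `σ`-almost everywhere and `σ`-integrable, and the linear functional `φ ↦ ∫ φ dσ` is
bounded. -/
def MemBesselLorentzDual {N : ℕ} (α s q : ℝ) (σ : Measure (EuclideanSpace ℝ (Fin N))) : Prop :=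
  ∃ C : ℝ, ∀ f : EuclideanSpace ℝ (Fin N) → ℝ, MemLorentz s q volume f →
    (∀ᵐ x ∂σ, Integrable (fun y => (besselKernel N α (x - y)).toReal * f y) volume) ∧
    Integrable (besselPotential α f) σ ∧
    |∫ x, besselPotential α f x ∂σ| ≤ C * (lorentzNorm s q volume f).toReal

end

/-!
Since `L^{s,q}` is normed by the averaged rearrangement `f**`, the potentials `G_α * f` of the
nonnegative functions in its unit ball form a convex set `T`. The construction reduces to finding,
for a finite measure `ν` with the same null sets as `μ`, a weight `g > 0` almost everywhere with
`sup_{k ∈ T} ∫ g k dν < ∞`. Indeed, if `ν = h μ` and `Kₙ` is an exhaustion of `Ω` by compact sets,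
then `μₙ = 1_{Kₙ} min (1, n g h) μ` increases to `μ`, lives on `Kₙ`, and is in the dual because
`∫ k dμₙ ≤ n ∫ g k dν`; both convergences are instances of dominated convergence.

The weight comes from two facts.

* `T` is bounded in `ν`-measure (`bounded_in_measure_ePotential`). Otherwise there are `fₖ` in the
  unit ball with `ν (G_α * fₖ > 4ᵏ) > ε`. The potential of `∑ 2⁻ᵏ fₖ`, which is in `L^{s,q}`, is then
  infinite on the upper limit of these sets. That set has capacity zero, since every multiple of
  the function is admissible, but its `ν`-measure is at least `ε`.
* A convex set of nonnegative functions that is bounded in measure has such a weight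
  (`exists_weight_of_bounded_in_probability`). The weight is the limit of `e^{-kₙ}` along a
  minimizing sequence of the strictly convex functional `k ↦ ∫ e^{-k} dν`. The parallelogram
  identity for `e^{-k/2}` gives almost everywhere convergence, boundedness in measure gives
  positivity, and the first-order condition at the minimum gives the bound.

Countable subadditivity of the Lorentz norm rests on the formula
`∫ τ in 0..t, f* (τ) = min over l of (t l + ∫ (|f| - l)⁺)`, with minimum at `l = f* (t)`
(`lintegral_eRearrangement_eq_min`), together with Minkowski's inequality.
-/

/-! ### Rearrangements and the Lorentz norm of functions with values in `[0, ∞]` -/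

section Rearrangement

variable {X : Type*} [MeasurableSpace X]

/-- The decreasing rearrangement of a function with values in `[0, ∞]`. -/
noncomputable def eRearrangement (ν : Measure X) (F : X → ℝ≥0∞) (t : ℝ) : ℝ≥0∞ :=
  sInf {r : ℝ≥0∞ | ν {x | r < F x} ≤ ENNReal.ofReal t}

/-- The averaged rearrangement of a function with values in `[0, ∞]`. -/
noncomputable def eAveraged (ν : Measure X) (F : X → ℝ≥0∞) (t : ℝ) : ℝ≥0∞ :=
  (ENNReal.ofReal t)⁻¹ * ∫⁻ τ in Ioc (0 : ℝ) t, eRearrangement ν F τ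

/-- The Lorentz norm of a function with values in `[0, ∞]`, so that
`lorentzNorm s q ν f = eLorentz s q ν (‖f ·‖ₑ)` by definition. Infinite values are allowed in order
to treat countable sums. -/
noncomputable def eLorentz (s q : ℝ) (ν : Measure X) (F : X → ℝ≥0∞) : ℝ≥0∞ :=
  (∫⁻ t in Ioi (0 : ℝ), ENNReal.ofReal (t ^ (q / s - 1)) * eAveraged ν F t ^ q) ^ (1 / q)

variable {ν : Measure X} {F G : X → ℝ≥0∞}

theorem lorentzNorm_eq_eLorentz (s q : ℝ) (f : X → ℝ) :
    lorentzNorm s q ν f = eLorentz s q ν (fun x => ‖f x‖ₑ) := rfl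

theorem eLorentz_congr_ae {s q : ℝ} (h : F =ᵐ[ν] G) : eLorentz s q ν F = eLorentz s q ν G := by
  -- the norm depends on the distribution function only
  have key : ∀ r : ℝ≥0∞, ν {x | r < F x} = ν {x | r < G x} := fun r =>
    measure_congr (by filter_upwards [h] with x hx; exact congrArg (fun y => r < y) hx)
  simp only [eLorentz, eAveraged, eRearrangement, key]

theorem antitone_eRearrangement : Antitone (eRearrangement ν F) := fun _ _ hst =>
  sInf_le_sInf fun _ hr => le_trans hr (ENNReal.ofReal_le_ofReal hst)

theorem measurable_eAveraged : Measurable (eAveraged ν F) := by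
  have h : Monotone fun t : ℝ => ∫⁻ τ in Ioc (0 : ℝ) t, eRearrangement ν F τ := fun a b hab =>
    lintegral_mono_set (Ioc_subset_Ioc_right hab)
  exact (ENNReal.measurable_ofReal.inv).mul h.measurable

/-- Right continuity of the distribution function turns the infimum defining `F*` into an
equivalence. -/
theorem lt_eRearrangement_iff {r : ℝ≥0∞} {t : ℝ} :
    r < eRearrangement ν F t ↔ ENNReal.ofReal t < ν {x | r < F x} := by
  constructor
  · intro h
    by_contra! hc
    exact absurd (sInf_le (show r ∈ {r : ℝ≥0∞ | ν {x | r < F x} ≤ ENNReal.ofReal t} from hc))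
      (not_le.2 h)
  · intro h
    by_contra! hc
    rcases eq_or_ne r ∞ with rfl | hr
    · simp at h
    obtain ⟨u, hu, hur, hul⟩ := exists_seq_strictAnti_tendsto' (lt_top_iff_ne_top.2 hr)
    have hle : ∀ n, ν {x | u n < F x} ≤ ENNReal.ofReal t := by
      intro n
      obtain ⟨r', hr', hlt⟩ := sInf_lt_iff.1 (lt_of_le_of_lt hc (hur n).1)
      exact le_trans (measure_mono fun x hx => lt_trans hlt hx) hr'
    have hU : {x | r < F x} = ⋃ n, {x | u n < F x} := by
      ext x
      simp only [mem_ofPred_eq, mem_iUnion]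
      constructor
      · intro hx
        exact (hul.eventually (gt_mem_nhds hx)).exists
      · rintro ⟨n, hn⟩
        exact lt_trans (hur n).1 hn
    have hmono : Monotone fun n => {x | u n < F x} := fun a b hab x hx =>
      lt_of_le_of_lt (hu.antitone hab) hx
    rw [hU, hmono.measure_iUnion] at h
    exact absurd (iSup_le hle) (not_le.2 h)

/-- The Lebesgue measure of `{r > 0 | a ≤ r < b}` is `b - a`, also for infinite endpoints. -/
theorem volume_ofReal_between (a b : ℝ≥0∞) :
    volume {r : ℝ | 0 < r ∧ a ≤ ENNReal.ofReal r ∧ ENNReal.ofReal r < b} = b - a := by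
  rcases le_or_gt b a with hab | hab
  · rw [tsub_eq_zero_of_le hab]
    convert measure_empty (μ := (volume : Measure ℝ))
    ext r
    simp only [mem_ofPred_eq, mem_empty_iff_false, iff_false]
    rintro ⟨_, h1, h2⟩
    exact absurd (lt_of_le_of_lt h1 h2) (not_lt.2 hab)
  lift a to ℝ≥0 using hab.ne_top
  rcases eq_or_ne b ∞ with rfl | hb
  · rw [ENNReal.top_sub_coe, eq_top_iff]
    refine (Real.volume_Ioi (a := (a : ℝ))).ge.trans (measure_mono fun r hr => ?_)
    have hr' : (a : ℝ) < r := hr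
    refine ⟨lt_of_le_of_lt a.2 hr', ?_, ENNReal.ofReal_lt_top⟩
    rw [← ENNReal.ofReal_coe_nnreal]
    exact ENNReal.ofReal_le_ofReal hr'.le
  lift b to ℝ≥0 using hb
  have h1 : (b : ℝ≥0∞) - a = ENNReal.ofReal ((b : ℝ) - a) := by
    rw [ENNReal.ofReal_sub _ a.coe_nonneg]; simp
  rw [h1]
  have hE : ∀ r : ℝ, 0 < r → (((a : ℝ≥0∞) ≤ ENNReal.ofReal r ↔ (a : ℝ) ≤ r) ∧
      (ENNReal.ofReal r < b ↔ r < (b : ℝ))) := by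
    intro r hr
    rw [← ENNReal.ofReal_coe_nnreal, ENNReal.ofReal_le_ofReal_iff hr.le,
      ← ENNReal.ofReal_coe_nnreal, ENNReal.ofReal_lt_ofReal_iff_of_nonneg hr.le]
    exact ⟨Iff.rfl, Iff.rfl⟩
  apply le_antisymm
  · rw [← Real.volume_Ico]
    exact measure_mono fun r ⟨h0, h2, h3⟩ => ⟨((hE r h0).1).1 h2, ((hE r h0).2).1 h3⟩
  · rw [← Real.volume_Ioo]
    refine measure_mono fun r hr => ?_
    have h0 : 0 < r := lt_of_le_of_lt a.2 hr.1
    exact ⟨h0, ((hE r h0).1).2 hr.1.le, ((hE r h0).2).2 hr.2⟩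

/-- Layer-cake formula for the truncation `(H - a)⁺`. -/
theorem lintegral_tsub_eq_layercake [SFinite ν] {H : X → ℝ≥0∞} (hH : AEMeasurable H ν) (a : ℝ≥0∞) :
    ∫⁻ x, (H x - a) ∂ν = ∫⁻ r in Ioi (0 : ℝ),
      {r : ℝ | a ≤ ENNReal.ofReal r}.indicator (fun r => ν {x | ENNReal.ofReal r < H x}) r := by
  wlog hm : Measurable H generalizing H
  · have h := this hH.measurable_mk.aemeasurable hH.measurable_mk
    have key : ∀ r : ℝ≥0∞, ν {x | r < H x} = ν {x | r < hH.mk H x} := fun r =>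
      measure_congr (by
        filter_upwards [hH.ae_eq_mk] with x hx; exact congrArg (fun y => r < y) hx)
    rw [lintegral_congr_ae (g := fun x => hH.mk H x - a)
      (by filter_upwards [hH.ae_eq_mk] with x hx; rw [hx]), h]
    simp only [key]
  let S : Set (X × ℝ) := {p | a ≤ ENNReal.ofReal p.2 ∧ ENNReal.ofReal p.2 < H p.1}
  have hS : MeasurableSet S :=
    (measurableSet_le measurable_const (ENNReal.measurable_ofReal.comp measurable_snd)).inter
      (measurableSet_lt (ENNReal.measurable_ofReal.comp measurable_snd) (hm.comp measurable_fst))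
  have hswap := lintegral_lintegral_swap (μ := ν) (ν := volume.restrict (Ioi (0 : ℝ)))
    (f := fun x r => S.indicator (fun _ => (1 : ℝ≥0∞)) (x, r))
    (measurable_const.indicator hS).aemeasurable
  have hL : ∀ x, ∫⁻ r in Ioi (0 : ℝ), S.indicator (fun _ => (1 : ℝ≥0∞)) (x, r) = H x - a := by
    intro x
    have hx : MeasurableSet {r : ℝ | (x, r) ∈ S} := measurable_prodMk_left hS
    rw [← volume_ofReal_between a (H x)]
    rw [show (fun r => S.indicator (fun _ => (1 : ℝ≥0∞)) (x, r))
      = {r : ℝ | (x, r) ∈ S}.indicator (fun _ => (1 : ℝ≥0∞)) from rfl,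
      lintegral_indicator hx, setLIntegral_one, Measure.restrict_apply hx]
    congr 1
    ext r
    simp only [S, mem_inter_iff, mem_ofPred_eq, mem_Ioi]
    tauto
  have hR : ∀ r, ∫⁻ x, S.indicator (fun _ => (1 : ℝ≥0∞)) (x, r) ∂ν =
      {r : ℝ | a ≤ ENNReal.ofReal r}.indicator (fun r => ν {x | ENNReal.ofReal r < H x}) r := by
    intro r
    have hx : MeasurableSet {x : X | (x, r) ∈ S} := measurable_prodMk_right hS
    rw [show (fun x => S.indicator (fun _ => (1 : ℝ≥0∞)) (x, r))
      = {x : X | (x, r) ∈ S}.indicator (fun _ => (1 : ℝ≥0∞)) from rfl,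
      lintegral_indicator hx, setLIntegral_one]
    by_cases har : a ≤ ENNReal.ofReal r <;> simp [S, har]
  simp only [hL, hR] at hswap
  exact hswap

theorem measurable_eRearrangement : Measurable (eRearrangement ν F) :=
  antitone_eRearrangement.measurable

theorem lintegral_eRearrangement_eq (t : ℝ) :
    ∫⁻ τ in Ioc (0 : ℝ) t, eRearrangement ν F τ =
      ∫⁻ r in Ioi (0 : ℝ), min (ENNReal.ofReal t) (ν {x | ENNReal.ofReal r < F x}) := by
  have h := lintegral_tsub_eq_layercake (ν := volume.restrict (Ioc (0 : ℝ) t))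
    (measurable_eRearrangement (ν := ν) (F := F)).aemeasurable 0
  simp only [tsub_zero, zero_le, ofPred_true, indicator_univ] at h
  rw [h]
  refine lintegral_congr fun r => ?_
  simp only [lt_eRearrangement_iff]
  set d := ν {x | ENNReal.ofReal r < F x}
  have hms : MeasurableSet {τ : ℝ | ENNReal.ofReal τ < d} :=
    measurableSet_lt ENNReal.measurable_ofReal measurable_const
  rw [Measure.restrict_apply hms]
  have h2 := volume_ofReal_between 0 (min (ENNReal.ofReal t) d)
  rw [tsub_zero] at h2
  rw [← h2]
  apply measure_congr
  have hne : ∀ᵐ τ : ℝ, τ ≠ t := by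
    simp [ae_iff, measure_singleton]
  refine eventuallyEq_set.2 ?_
  filter_upwards [hne] with τ hτ
  simp only [mem_inter_iff, mem_ofPred_eq, mem_Ioc, zero_le, true_and, lt_min_iff]
  constructor
  · rintro ⟨h1, h3, h4⟩
    have h5 := lt_of_le_of_ne h4 hτ
    exact ⟨h3, (ENNReal.ofReal_lt_ofReal_iff (h3.trans h5)).2 h5, h1⟩
  · rintro ⟨h1, h3, h4⟩
    exact ⟨h4, h1, ((ENNReal.ofReal_lt_ofReal_iff_of_nonneg h1.le).1 h3).le⟩

theorem mul_add_lintegral_tsub_eq [SFinite ν] (hF : AEMeasurable F ν) (t : ℝ) (l : ℝ≥0∞) :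
    ENNReal.ofReal t * l + ∫⁻ x, (F x - l) ∂ν =
      ∫⁻ r in Ioi (0 : ℝ), if ENNReal.ofReal r < l then ENNReal.ofReal t else
        ν {x | ENNReal.ofReal r < F x} := by
  have hms : MeasurableSet {r : ℝ | ENNReal.ofReal r < l} :=
    measurableSet_lt ENNReal.measurable_ofReal measurable_const
  have h2 := volume_ofReal_between 0 l
  rw [tsub_zero] at h2
  have h3 : ENNReal.ofReal t * l = ∫⁻ r in Ioi (0 : ℝ),
      {r : ℝ | ENNReal.ofReal r < l}.indicator (fun _ => ENNReal.ofReal t) r := by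
    rw [lintegral_indicator hms, setLIntegral_const, Measure.restrict_apply hms]
    congr 1
    refine h2.symm.trans (congrArg volume ?_)
    ext r
    simp [and_comm]
  rw [h3, lintegral_tsub_eq_layercake hF, ← lintegral_add_left (measurable_const.indicator hms)]
  refine lintegral_congr fun r => ?_
  by_cases h : ENNReal.ofReal r < l
  · simp [h]
  · simp [h, not_lt.1 h]

theorem lintegral_eRearrangement_le [SFinite ν] (hF : AEMeasurable F ν) (t : ℝ) (l : ℝ≥0∞) :
    ∫⁻ τ in Ioc (0 : ℝ) t, eRearrangement ν F τ ≤
      ENNReal.ofReal t * l + ∫⁻ x, (F x - l) ∂ν := by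
  rw [mul_add_lintegral_tsub_eq hF, lintegral_eRearrangement_eq]
  refine lintegral_mono fun r => ?_
  dsimp only
  split_ifs
  · exact min_le_left _ _
  · exact min_le_right _ _

/-- The infimum of `l ↦ t l + ∫ (F - l)⁺` is `∫ τ in 0..t, F* (τ)`, attained at `l = F* (t)`. -/
theorem lintegral_eRearrangement_eq_min [SFinite ν] (hF : AEMeasurable F ν) (t : ℝ) :
    ∫⁻ τ in Ioc (0 : ℝ) t, eRearrangement ν F τ =
      ENNReal.ofReal t * eRearrangement ν F t + ∫⁻ x, (F x - eRearrangement ν F t) ∂ν := by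
  rw [mul_add_lintegral_tsub_eq hF, lintegral_eRearrangement_eq]
  refine lintegral_congr fun r => ?_
  split_ifs with h
  · exact min_eq_left (lt_eRearrangement_iff.1 h).le
  · exact min_eq_right (not_lt.1 fun h' => h (lt_eRearrangement_iff.2 h'))

/-- Countable subadditivity of `F**`: use the level `∑ᵢ Hᵢ* (t)` for the sum and the inequality
`(∑ᵢ Hᵢ - ∑ᵢ lᵢ)⁺ ≤ ∑ᵢ (Hᵢ - lᵢ)⁺`. -/
theorem eAveraged_tsum_le [SFinite ν] {ι : Type*} [Countable ι] {H : ι → X → ℝ≥0∞}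
    (hH : ∀ i, AEMeasurable (H i) ν) (t : ℝ) :
    eAveraged ν (fun x => ∑' i, H i x) t ≤ ∑' i, eAveraged ν (H i) t := by
  simp only [eAveraged]
  rw [ENNReal.tsum_mul_left]
  gcongr
  refine (lintegral_eRearrangement_le (AEMeasurable.tsum hH) t
    (∑' i, eRearrangement ν (H i) t)).trans ?_
  simp_rw [fun i => lintegral_eRearrangement_eq_min (hH i) t]
  rw [ENNReal.tsum_add, ENNReal.tsum_mul_left]
  gcongr
  rw [← lintegral_tsum (f := fun i x => H i x - eRearrangement ν (H i) t)
    fun i => (hH i).sub aemeasurable_const]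
  refine lintegral_mono fun x => ?_
  rw [tsub_le_iff_right, ← ENNReal.tsum_add]
  exact ENNReal.tsum_le_tsum fun i => le_tsub_add

theorem eAveraged_const_mul_le {c : ℝ≥0∞} (hc : c ≠ 0) (hc' : c ≠ ∞) (t : ℝ) :
    eAveraged ν (fun x => c * F x) t ≤ c * eAveraged ν F t := by
  simp only [eAveraged]
  rw [mul_left_comm, ← lintegral_const_mul' _ _ hc']
  gcongr with τ
  simp only [eRearrangement]
  rw [← ENNReal.div_le_iff' hc hc']
  refine le_sInf fun r hr => ?_
  rw [ENNReal.div_le_iff' hc hc']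
  refine sInf_le ?_
  refine le_trans (measure_mono fun x hx => ?_) hr
  exact (ENNReal.mul_lt_mul_iff_right hc hc').1 hx

variable {s q : ℝ}

theorem eLorentz_const_mul_le (hq : 1 ≤ q) {c : ℝ≥0∞} (hc : c ≠ 0) (hc' : c ≠ ∞) :
    eLorentz s q ν (fun x => c * F x) ≤ c * eLorentz s q ν F := by
  have hq0 : 0 < q := by linarith
  calc eLorentz s q ν (fun x => c * F x)
      ≤ (∫⁻ t in Ioi (0 : ℝ), c ^ q * (ENNReal.ofReal (t ^ (q / s - 1)) *
          eAveraged ν F t ^ q)) ^ (1 / q) := by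
        unfold eLorentz
        refine ENNReal.rpow_le_rpow (lintegral_mono fun t => ?_) (by positivity)
        rw [mul_left_comm, ← ENNReal.mul_rpow_of_nonneg _ _ hq0.le]
        gcongr
        exact eAveraged_const_mul_le hc hc' t
    _ = c * eLorentz s q ν F := by
        rw [lintegral_const_mul' _ _ (ENNReal.rpow_ne_top_of_nonneg hq0.le hc'),
          ENNReal.mul_rpow_of_nonneg _ _ (by positivity), ← ENNReal.rpow_mul,
          mul_one_div_cancel hq0.ne', ENNReal.rpow_one]
        rfl

/-- The measure `t ^ (q / s - 1) dt` on `(0, ∞)`, in terms of which the Lorentz norm is the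
`L^q` norm of the averaged rearrangement. -/
noncomputable def lorentzWeight (s q : ℝ) : Measure ℝ :=
  (volume.restrict (Ioi (0 : ℝ))).withDensity fun t => ENNReal.ofReal (t ^ (q / s - 1))

theorem eLorentz_eq_lorentzWeight :
    eLorentz s q ν F = (∫⁻ t, eAveraged ν F t ^ q ∂(lorentzWeight s q)) ^ (1 / q) := by
  rw [lorentzWeight, lintegral_withDensity_eq_lintegral_mul _ (by fun_prop)
    (measurable_eAveraged.pow_const q)]
  rfl

/-- Minkowski's inequality for countable sums. -/
theorem lintegral_Lp_tsum_le {Y : Type*} [MeasurableSpace Y] {m : Measure Y} (hq : 1 ≤ q)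
    {A : ℕ → Y → ℝ≥0∞} (hA : ∀ i, Measurable (A i)) :
    (∫⁻ t, (∑' i, A i t) ^ q ∂m) ^ (1 / q) ≤ ∑' i, (∫⁻ t, A i t ^ q ∂m) ^ (1 / q) := by
  have hq0 : 0 < q := by linarith
  have hfin : ∀ n, (∫⁻ t, (∑ i ∈ Finset.range n, A i t) ^ q ∂m) ^ (1 / q) ≤
      ∑ i ∈ Finset.range n, (∫⁻ t, A i t ^ q ∂m) ^ (1 / q) := by
    intro n
    induction n with
    | zero => simp [hq0]
    | succ n ih =>
      simp only [Finset.sum_range_succ]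
      have h := ENNReal.lintegral_Lp_add_le (μ := m)
        (f := fun t => ∑ i ∈ Finset.range n, A i t) (g := A n)
        (Finset.measurable_fun_sum _ fun i _ => hA i).aemeasurable (hA n).aemeasurable hq
      exact h.trans (by gcongr)
  have hlim : ∫⁻ t, (∑' i, A i t) ^ q ∂m = ⨆ n, ∫⁻ t, (∑ i ∈ Finset.range n, A i t) ^ q ∂m := by
    rw [← lintegral_iSup (fun n => (Finset.measurable_fun_sum _ fun i _ => hA i).pow_const q)]
    · refine lintegral_congr fun t => ?_
      rw [ENNReal.tsum_eq_iSup_nat]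
      exact (ENNReal.orderIsoRpow q hq0).map_iSup _
    · intro a b hab t
      dsimp only
      gcongr
  rw [hlim]
  have h2 := (ENNReal.orderIsoRpow (1 / q) (by positivity)).map_iSup
    fun n => ∫⁻ t, (∑ i ∈ Finset.range n, A i t) ^ q ∂m
  simp only [ENNReal.orderIsoRpow_apply] at h2
  rw [h2]
  exact iSup_le fun n => (hfin n).trans (ENNReal.sum_le_tsum _)

theorem eLorentz_tsum_le [SFinite ν] (hq : 1 ≤ q) {H : ℕ → X → ℝ≥0∞}
    (hH : ∀ i, AEMeasurable (H i) ν) :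
    eLorentz s q ν (fun x => ∑' i, H i x) ≤ ∑' i, eLorentz s q ν (H i) := by
  simp only [eLorentz_eq_lorentzWeight]
  refine le_trans ?_ (lintegral_Lp_tsum_le hq fun i => measurable_eAveraged)
  gcongr with t
  exact eAveraged_tsum_le hH t

theorem eLorentz_add_le [SFinite ν] (hq : 1 ≤ q) (hF : AEMeasurable F ν) (hG : AEMeasurable G ν) :
    eLorentz s q ν (fun x => F x + G x) ≤ eLorentz s q ν F + eLorentz s q ν G := by
  simp only [eLorentz_eq_lorentzWeight]
  refine le_trans ?_ (ENNReal.lintegral_Lp_add_le measurable_eAveraged.aemeasurable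
    measurable_eAveraged.aemeasurable hq)
  gcongr with t
  have h := eAveraged_tsum_le (ν := ν) (H := fun b : Bool => if b then F else G)
    (by rintro (_ | _) <;> simpa) t
  simpa [tsum_bool, add_comm] using h

theorem eLorentz_zero (hq : 1 ≤ q) : eLorentz s q ν (fun _ => 0) = 0 := by
  have hq0 : 0 < q := by linarith
  simp [eLorentz, eAveraged, eRearrangement, hq0]

/-- A function of finite Lorentz norm is finite almost everywhere: otherwise its rearrangement is
infinite near `0`. -/
theorem ae_lt_top_of_eLorentz (hq : 1 ≤ q) (h : eLorentz s q ν F < ∞) : ∀ᵐ x ∂ν, F x < ∞ := by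
  have hq0 : 0 < q := by linarith
  by_contra hc
  have hpos : 0 < ν {x | F x = ∞} := by
    rw [pos_iff_ne_zero]
    intro h0
    exact hc (by simpa [ae_iff] using h0)
  obtain ⟨t₀, ht₀, ht₁⟩ := ENNReal.lt_iff_exists_real_btwn.1 hpos
  obtain ⟨ht₁, ht₂⟩ := ht₁
  have ht₀' : 0 < t₀ := ENNReal.ofReal_pos.1 ht₁
  have hre : ∀ τ ≤ t₀, eRearrangement ν F τ = ∞ := by
    intro τ hτ
    refine ENNReal.eq_top_of_forall_nnreal_le fun r => ?_
    refine (lt_eRearrangement_iff.2 ?_).le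
    refine lt_of_le_of_lt (ENNReal.ofReal_le_ofReal hτ) (lt_of_lt_of_le ht₂ ?_)
    exact measure_mono fun x (hx : F x = ∞) => by simp [hx]
  have hav : ∀ t ∈ Ioc 0 t₀, eAveraged ν F t = ∞ := by
    intro t ht
    have : ∫⁻ τ in Ioc (0 : ℝ) t, eRearrangement ν F τ = ∞ := by
      rw [setLIntegral_congr_fun (g := fun _ => ∞) measurableSet_Ioc
        fun τ hτ => hre τ (hτ.2.trans ht.2)]
      simp [ENNReal.top_mul, ht.1]
    rw [eAveraged, this, ENNReal.mul_top]
    simp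
  refine h.ne ?_
  have : ∫⁻ t in Ioi (0 : ℝ), ENNReal.ofReal (t ^ (q / s - 1)) * eAveraged ν F t ^ q = ∞ := by
    refine eq_top_iff.2 (le_trans ?_ (lintegral_mono_set (s := Ioc 0 t₀) fun t ht => ht.1))
    rw [setLIntegral_congr_fun (g := fun _ => ∞) measurableSet_Ioc]
    · simp [ENNReal.top_mul, ht₀']
    · intro t ht
      have hw : ENNReal.ofReal (t ^ (q / s - 1)) ≠ 0 := by
        simpa using Real.rpow_pos_of_pos ht.1 _
      simp only [hav t ht, ENNReal.top_rpow_of_pos hq0, ENNReal.mul_top hw]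
  rw [eLorentz, this, ENNReal.top_rpow_of_pos (by positivity)]

end Rearrangement

/-! ### Weights for convex sets bounded in measure -/

section Factorization

variable {X : Type*} [MeasurableSpace X]

theorem integrable_exp_neg_toReal {ν : Measure X} [IsFiniteMeasure ν] {k : X → ℝ≥0∞}
    (hk : Measurable k) {c : ℝ} (hc : 0 ≤ c) :
    Integrable (fun x => Real.exp (-(c * (k x).toReal))) ν := by
  refine Integrable.of_bound (C := 1) (Measurable.aestronglyMeasurable (by fun_prop))
    (Eventually.of_forall fun x => ?_)
  rw [Real.norm_of_nonneg (Real.exp_pos _).le]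
  exact Real.exp_le_one_iff.2 (neg_nonpos.2 (mul_nonneg hc ENNReal.toReal_nonneg))

/-- A sequence whose consecutive distances decay geometrically in `L²` converges almost
everywhere. -/
theorem ae_exists_tendsto_of_integral_sq_le {ν : Measure X} [IsFiniteMeasure ν] {u : ℕ → X → ℝ}
    (hu : ∀ n, Measurable (u n)) (hi : ∀ n, Integrable (fun x => (u n x - u (n + 1) x) ^ 2) ν)
    {c : ℝ} (h : ∀ n, ∫ x, (u n x - u (n + 1) x) ^ 2 ∂ν ≤ c * (1 / 4) ^ n) :
    ∀ᵐ x ∂ν, ∃ l, Tendsto (fun n => u n x) atTop (𝓝 l) := by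
  have hb : ∀ n, ∫⁻ x, ENNReal.ofReal |u n x - u (n + 1) x| ∂ν ≤
      ENNReal.ofReal ((c + ν.real univ) * (1 / 2) ^ n) := by
    intro n
    have hint : Integrable (fun x => 2 ^ n * (u n x - u (n + 1) x) ^ 2 + (1 / 2) ^ n) ν :=
      ((hi n).const_mul _).add (integrable_const _)
    calc ∫⁻ x, ENNReal.ofReal |u n x - u (n + 1) x| ∂ν
        ≤ ∫⁻ x, ENNReal.ofReal (2 ^ n * (u n x - u (n + 1) x) ^ 2 + (1 / 2) ^ n) ∂ν := by
          refine lintegral_mono fun x => ENNReal.ofReal_le_ofReal ?_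
          have h2 : (2 : ℝ) ^ n * (1 / 2) ^ n = 1 := by rw [← mul_pow]; norm_num
          have h3 : (0 : ℝ) < 2 ^ n := by positivity
          have h4 : (0 : ℝ) < (1 / 2) ^ n := by positivity
          rw [← sq_abs (u n x - u (n + 1) x)]
          set a := |u n x - u (n + 1) x|
          have ha : 0 ≤ a := abs_nonneg _
          -- `2ⁿ a² - a + 2⁻ⁿ = 2ⁿ (a - 2⁻ⁿ)² + a ≥ 0`
          nlinarith [mul_nonneg h3.le (sq_nonneg (a - (1 / 2) ^ n))]
      _ = ENNReal.ofReal (∫ x, (2 ^ n * (u n x - u (n + 1) x) ^ 2 + (1 / 2) ^ n) ∂ν) :=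
          (ofReal_integral_eq_lintegral_ofReal hint
            (Eventually.of_forall fun x => by positivity)).symm
      _ ≤ _ := by
          refine ENNReal.ofReal_le_ofReal ?_
          rw [integral_add ((hi n).const_mul _) (integrable_const _), integral_const_mul,
            integral_const, smul_eq_mul, add_mul]
          rw [mul_comm (ν.real univ)]
          refine add_le_add_left ?_ _
          calc (2 : ℝ) ^ n * ∫ x, (u n x - u (n + 1) x) ^ 2 ∂ν ≤ 2 ^ n * (c * (1 / 4) ^ n) := by
                gcongr; exact h n
            _ = c * (1 / 2) ^ n := by
                rw [mul_left_comm, ← mul_pow]; norm_num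
  have hsum : ∫⁻ x, ∑' n, ENNReal.ofReal |u n x - u (n + 1) x| ∂ν < ∞ := by
    rw [lintegral_tsum fun n => by fun_prop]
    refine lt_of_le_of_lt (ENNReal.tsum_le_tsum hb) (lt_of_le_of_lt (ENNReal.tsum_le_tsum
      fun n => ENNReal.ofReal_le_ofReal (q := |c + ν.real univ| * (1 / 2) ^ n) ?_) ?_)
    · gcongr; exact le_abs_self _
    · rw [← ENNReal.ofReal_tsum_of_nonneg (fun n => by positivity)
        ((summable_geometric_of_lt_one (by norm_num) (by norm_num)).mul_left _)]
      exact ENNReal.ofReal_lt_top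
  filter_upwards [ae_lt_top' (by fun_prop) hsum.ne] with x hx
  refine cauchySeq_tendsto_of_complete (cauchySeq_of_summable_dist ?_)
  have := ENNReal.summable_toReal hx.ne
  refine this.congr fun n => ?_
  rw [ENNReal.toReal_ofReal (abs_nonneg _), Real.dist_eq]

theorem exp_neg_sub_exp_neg_le {t y : ℝ} (ht0 : 0 ≤ t) (ht : t ≤ 1 / 2) (hy : 0 ≤ y) :
    Real.exp (-((1 - t) * y)) - Real.exp (-y) ≤ 2 * t := by
  have h1 : Real.exp (-((1 - t) * y)) - Real.exp (-y) =
      Real.exp (-((1 - t) * y)) * (1 - Real.exp (-(t * y))) := by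
    rw [mul_sub, ← Real.exp_add]; ring_nf
  have h2 : 1 - Real.exp (-(t * y)) ≤ t * y := by
    have := Real.add_one_le_exp (-(t * y)); linarith
  have h3 : Real.exp (-((1 - t) * y)) ≤ Real.exp (-(y / 2)) :=
    Real.exp_le_exp.2 (by nlinarith)
  have h4 : Real.exp (-(y / 2)) * (y / 2) ≤ 1 := by
    rw [Real.exp_neg, inv_mul_le_one₀ (Real.exp_pos _)]
    have := Real.add_one_le_exp (y / 2); linarith
  have h5 : 0 ≤ t * y := by positivity
  rw [h1]
  calc _ ≤ Real.exp (-(y / 2)) * (t * y) := by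
        refine mul_le_mul h3 h2 ?_ (Real.exp_pos _).le
        rw [sub_nonneg, Real.exp_le_one_iff]; linarith
    _ = 2 * t * (Real.exp (-(y / 2)) * (y / 2)) := by ring
    _ ≤ 2 * t * 1 := by gcongr
    _ = 2 * t := by ring

/-- **Factorization of a convex set bounded in probability** (in the spirit of Nikishin, Maurey and
Yan). The weight is `g = lim e^{-kₙ}` for a sequence `kₙ ∈ T` minimizing `k ↦ ∫ e^{-k} dν`; strict
convexity of this functional gives the convergence, and its first variation at the minimum gives
the bound `∫ g k dν ≤ 2 ν(X)`. -/
theorem exists_weight_of_bounded_in_probability {ν : Measure X} [IsFiniteMeasure ν]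
    {T : Set (X → ℝ≥0∞)} (hne : T.Nonempty) (hmeas : ∀ k ∈ T, Measurable k)
    (hconv : ∀ k ∈ T, ∀ k' ∈ T, ∀ t : ℝ, 0 < t → t < 1 →
      (fun x => ENNReal.ofReal (1 - t) * k x + ENNReal.ofReal t * k' x) ∈ T)
    (hbdd : ∀ ε : ℝ≥0∞, 0 < ε → ∃ l : ℝ, ∀ k ∈ T, ν {x | ENNReal.ofReal l < k x} ≤ ε) :
    ∃ g : X → ℝ≥0∞, Measurable g ∧ (∀ᵐ x ∂ν, 0 < g x) ∧
      ∀ k ∈ T, ∫⁻ x, g x * k x ∂ν ≤ 2 * ν univ := by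
  have hfin : ∀ k ∈ T, ∀ᵐ x ∂ν, k x < ∞ := by
    intro k hk
    rw [ae_iff]
    refine le_antisymm (ENNReal.le_of_forall_pos_le_add fun ε hε _ => ?_) (zero_le)
    obtain ⟨l, hl⟩ := hbdd ε (by exact_mod_cast hε)
    rw [zero_add]
    exact le_trans (measure_mono fun x hx => by simp_all) (hl k hk)
  let e : (X → ℝ≥0∞) → ℝ → X → ℝ := fun k c x => Real.exp (-(c * (k x).toReal))
  have he : ∀ k ∈ T, ∀ c, 0 ≤ c → Integrable (e k c) ν := fun k hk c hc =>
    integrable_exp_neg_toReal (hmeas k hk) hc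
  let J : (X → ℝ≥0∞) → ℝ := fun k => ∫ x, e k 1 x ∂ν
  have hJ0 : ∀ k, 0 ≤ J k := fun k => integral_nonneg fun x => (Real.exp_pos _).le
  let I := sInf (J '' T)
  have hIle : ∀ k ∈ T, I ≤ J k := fun k hk =>
    csInf_le ⟨0, by rintro _ ⟨k, _, rfl⟩; exact hJ0 k⟩ ⟨k, hk, rfl⟩
  have hex : ∀ n : ℕ, ∃ k ∈ T, J k < I + (1 / 4) ^ n := by
    intro n
    obtain ⟨_, ⟨k, hk, rfl⟩, hlt⟩ := exists_lt_of_csInf_lt (hne.image J)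
      (lt_add_of_pos_right I (show (0 : ℝ) < (1 / 4) ^ n by positivity))
    exact ⟨k, hk, hlt⟩
  choose k hkT hkJ using hex
  -- the exponential of a convex combination
  have hcomb : ∀ a ∈ T, ∀ b ∈ T, ∀ t : ℝ, 0 < t → t < 1 →
      I ≤ ∫ x, e a (1 - t) x * e b t x ∂ν := by
    intro a ha b hb t ht0 ht1
    refine (hIle _ (hconv a ha b hb t ht0 ht1)).trans (integral_congr_ae ?_).le
    filter_upwards [hfin a ha, hfin b hb] with x hxa hxb
    simp only [e]
    rw [ENNReal.toReal_add (ENNReal.mul_ne_top ENNReal.ofReal_ne_top hxa.ne)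
      (ENNReal.mul_ne_top ENNReal.ofReal_ne_top hxb.ne), ENNReal.toReal_mul, ENNReal.toReal_mul,
      ENNReal.toReal_ofReal (by linarith), ENNReal.toReal_ofReal ht0.le, ← Real.exp_add]
    ring_nf
  have hprod : ∀ a ∈ T, ∀ b ∈ T, ∀ c d : ℝ, 0 ≤ c → 0 ≤ d →
      Integrable (fun x => e a c x * e b d x) ν := by
    intro a ha b hb c d hc hd
    refine (he a ha c hc).mul_bdd (c := 1) (he b hb d hd).aestronglyMeasurable
      (Eventually.of_forall fun x => ?_)
    rw [Real.norm_of_nonneg (Real.exp_pos _).le]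
    exact Real.exp_le_one_iff.2 (neg_nonpos.2 (mul_nonneg hd ENNReal.toReal_nonneg))
  have hsq : ∀ a x, e a (1 / 2) x * e a (1 / 2) x = e a 1 x := by
    intro a x
    simp only [e]
    rw [← Real.exp_add]; ring_nf
  have hexpand : ∀ n x, (e (k n) (1 / 2) x - e (k (n + 1)) (1 / 2) x) ^ 2 =
      (e (k n) 1 x + e (k (n + 1)) 1 x) - 2 * (e (k n) (1 / 2) x * e (k (n + 1)) (1 / 2) x) := by
    intro n x
    rw [← hsq (k n), ← hsq (k (n + 1))]; ring
  have hint : ∀ n, Integrable (fun x => (e (k n) 1 x + e (k (n + 1)) 1 x) -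
      2 * (e (k n) (1 / 2) x * e (k (n + 1)) (1 / 2) x)) ν := fun n =>
    ((he _ (hkT n) 1 zero_le_one).add (he _ (hkT (n + 1)) 1 zero_le_one)).sub
      ((hprod _ (hkT n) _ (hkT (n + 1)) _ _ (by norm_num) (by norm_num)).const_mul 2)
  have hlim : ∀ᵐ x ∂ν, ∃ l, Tendsto (fun n => e (k n) (1 / 2) x) atTop (𝓝 l) := by
    refine ae_exists_tendsto_of_integral_sq_le (c := 2) (fun n => ?_) (fun n => ?_) fun n => ?_
    · have := hmeas _ (hkT n)
      fun_prop
    · simpa only [hexpand] using hint n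
    · simp only [hexpand]
      rw [integral_sub (f := fun x => e (k n) 1 x + e (k (n + 1)) 1 x)
        ((he _ (hkT n) 1 zero_le_one).add (he _ (hkT (n + 1)) 1 zero_le_one))
        ((hprod _ (hkT n) _ (hkT (n + 1)) (1 / 2) (1 / 2) (by norm_num) (by norm_num)).const_mul 2),
        integral_add (he _ (hkT n) 1 zero_le_one) (he _ (hkT (n + 1)) 1 zero_le_one),
        integral_const_mul]
      have h1 := hcomb _ (hkT n) _ (hkT (n + 1)) (1 / 2) (by norm_num) (by norm_num)
      have h2 := hkJ n
      have h3 := hkJ (n + 1)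
      have h4 : (0 : ℝ) < (1 / 4) ^ n := by positivity
      rw [pow_succ] at h3
      norm_num at h1
      simp only [J] at h2 h3
      linarith
  have hmeas2 : ∀ n, Measurable (e (k n) (1 / 2)) := fun n => by
    have := hmeas _ (hkT n)
    fun_prop
  obtain ⟨u, hu, hul⟩ := measurable_limit_of_tendsto_metrizable_ae
    (fun n => (hmeas2 n).aemeasurable) hlim
  have hul1 : ∀ᵐ x ∂ν, Tendsto (fun n => e (k n) 1 x) atTop (𝓝 (u x ^ 2)) := by
    filter_upwards [hul] with x hx
    have := hx.mul hx
    simpa only [hsq, ← sq] using this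
  refine ⟨fun x => ENNReal.ofReal (u x ^ 2), by fun_prop, ?_, ?_⟩
  · rw [ae_iff]
    refine le_antisymm (ENNReal.le_of_forall_pos_le_add fun ε hε _ => ?_) (zero_le)
    obtain ⟨l, hl⟩ := hbdd ε (by exact_mod_cast hε)
    rw [zero_add]
    -- where the limit vanishes, `kₙ > l` for all large `n`
    have hsub : ν {x | ¬ 0 < ENNReal.ofReal (u x ^ 2)} ≤
        ν (⋃ m, ⋂ n ≥ m, {x | ENNReal.ofReal l < k n x}) := by
      refine measure_mono_ae ?_
      filter_upwards [hul1, ae_all_iff.2 fun n => hfin _ (hkT n)] with x hx hxf hx0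
      replace hx0 : ¬ 0 < ENNReal.ofReal (u x ^ 2) := hx0
      have hx0' : u x ^ 2 = 0 := by
        have : ¬ 0 < u x ^ 2 := by simpa only [ENNReal.ofReal_pos] using hx0
        exact le_antisymm (not_lt.1 this) (sq_nonneg _)
      rw [hx0'] at hx
      obtain ⟨m, hm⟩ := eventually_atTop.1 (hx.eventually (gt_mem_nhds (Real.exp_pos (-(max l 0)))))
      refine mem_iUnion.2 ⟨m, mem_iInter₂.2 fun n hn => ?_⟩
      have := Real.exp_lt_exp.1 (hm n hn)
      rw [one_mul, neg_lt_neg_iff] at this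
      exact (ENNReal.ofReal_le_ofReal (le_max_left l 0)).trans_lt
        ((ENNReal.ofReal_lt_iff_lt_toReal (le_max_right l 0) (hxf n).ne).2 this)
    refine hsub.trans ?_
    rw [Monotone.measure_iUnion]
    · exact iSup_le fun m => (measure_mono (iInter₂_subset m le_rfl)).trans (hl _ (hkT m))
    · intro a b hab
      exact biInter_subset_biInter_left fun n hn => le_trans hab hn
  · intro b hb
    have hb' := hmeas b hb
    -- the first variation at `kₙ` in the direction of `b`
    have hvar : ∀ t : ℝ, 0 < t → t ≤ 1 / 2 → ∀ n,
        ∫ x, e (k n) 1 x * (1 - e b t x) ∂ν ≤ 2 * t * ν.real univ + (1 / 4) ^ n := by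
      intro t ht0 ht1 n
      have i1 := he _ (hkT n) 1 zero_le_one
      have i2 := he _ (hkT n) (1 - t) (by linarith)
      have i3 := hprod _ (hkT n) b hb (1 - t) t (by linarith) ht0.le
      have i4 := hprod _ (hkT n) b hb 1 t zero_le_one ht0.le
      have h1 := hcomb _ (hkT n) b hb t ht0 (by linarith)
      have h2 : ∫ x, (e (k n) (1 - t) x - e (k n) 1 x) ∂ν ≤ ∫ _, 2 * t ∂ν := by
        refine integral_mono (i2.sub i1) (integrable_const _) fun x => ?_
        simpa [e] using exp_neg_sub_exp_neg_le ht0.le ht1 (ENNReal.toReal_nonneg (a := k n x))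
      rw [integral_const, smul_eq_mul, integral_sub i2 i1] at h2
      have h3 : ∫ x, e (k n) 1 x * (1 - e b t x) ∂ν ≤
          ∫ x, (e (k n) (1 - t) x - e (k n) (1 - t) x * e b t x) ∂ν := by
        refine integral_mono ?_ (i2.sub i3) fun x => ?_
        · simp only [mul_sub, mul_one]
          exact i1.sub i4
        · have h5 : e (k n) 1 x ≤ e (k n) (1 - t) x :=
            Real.exp_le_exp.2 (by nlinarith [ENNReal.toReal_nonneg (a := k n x)])
          have h6 : e b t x ≤ 1 :=
            Real.exp_le_one_iff.2 (neg_nonpos.2 (mul_nonneg ht0.le ENNReal.toReal_nonneg))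
          nlinarith
      rw [integral_sub i2 i3] at h3
      have h4 := hkJ n
      simp only [J] at h4
      linarith
    -- let `n → ∞` and divide by `t`, using `y / (1 + t y) ≤ (1 - e^{-t y}) / t`
    have hpass : ∀ t : ℝ, 0 < t → t ≤ 1 / 2 →
        ∫⁻ x, ENNReal.ofReal (u x ^ 2 * ((b x).toReal / (1 + t * (b x).toReal))) ∂ν
          ≤ 2 * ν univ := by
      intro t ht0 ht1
      have hpos : ∀ x, 0 ≤ 1 - e b t x := fun x => by
        rw [sub_nonneg]
        exact Real.exp_le_one_iff.2 (neg_nonpos.2 (mul_nonneg ht0.le ENNReal.toReal_nonneg))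
      have hF : ∫⁻ x, ENNReal.ofReal (u x ^ 2 * (1 - e b t x)) ∂ν ≤
          ENNReal.ofReal (2 * t * ν.real univ) := by
        have h1 : ∫⁻ x, ENNReal.ofReal (u x ^ 2 * (1 - e b t x)) ∂ν =
            ∫⁻ x, liminf (fun n => ENNReal.ofReal (e (k n) 1 x * (1 - e b t x))) atTop ∂ν := by
          refine lintegral_congr_ae ?_
          filter_upwards [hul1] with x hx
          exact ((ENNReal.continuous_ofReal.tendsto _).comp (hx.mul_const _)).liminf_eq.symm
        rw [h1]
        refine (lintegral_liminf_le fun n => ?_).trans ?_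
        · have := hmeas _ (hkT n)
          fun_prop
        have h2 : ∀ n, ∫⁻ x, ENNReal.ofReal (e (k n) 1 x * (1 - e b t x)) ∂ν ≤
            ENNReal.ofReal (2 * t * ν.real univ + (1 / 4) ^ n) := by
          intro n
          rw [← ofReal_integral_eq_lintegral_ofReal]
          · exact ENNReal.ofReal_le_ofReal (hvar t ht0 ht1 n)
          · simp only [mul_sub, mul_one]
            exact (he _ (hkT n) 1 zero_le_one).sub
              (hprod _ (hkT n) b hb 1 t zero_le_one ht0.le)
          · exact Eventually.of_forall fun x => mul_nonneg (Real.exp_pos _).le (hpos x)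
        have h3 : Tendsto (fun n : ℕ => ENNReal.ofReal (2 * t * ν.real univ + (1 / 4) ^ n)) atTop
            (𝓝 (ENNReal.ofReal (2 * t * ν.real univ))) := by
          refine (ENNReal.continuous_ofReal.tendsto _).comp ?_
          simpa using (tendsto_pow_atTop_nhds_zero_of_lt_one (by norm_num : (0 : ℝ) ≤ 1 / 4)
            (by norm_num)).const_add (2 * t * ν.real univ)
        rw [← h3.liminf_eq]
        exact liminf_le_liminf (Eventually.of_forall h2)
      have hle : ∀ x, ENNReal.ofReal (u x ^ 2 * ((b x).toReal / (1 + t * (b x).toReal))) ≤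
          ENNReal.ofReal t⁻¹ * ENNReal.ofReal (u x ^ 2 * (1 - e b t x)) := by
        intro x
        rw [← ENNReal.ofReal_mul (by positivity)]
        refine ENNReal.ofReal_le_ofReal ?_
        rw [mul_left_comm]
        gcongr
        set y := (b x).toReal with hy
        have hy0 : 0 ≤ y := ENNReal.toReal_nonneg
        have h1 : e b t x ≤ (1 + t * y)⁻¹ := by
          simp only [e]
          rw [Real.exp_neg]
          gcongr
          have := Real.add_one_le_exp (t * y)
          linarith
        have h2 : y / (1 + t * y) = t⁻¹ * (1 - (1 + t * y)⁻¹) := by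
          have : 1 + t * y ≠ 0 := by positivity
          field_simp
          ring
        rw [h2]
        gcongr
      calc _ ≤ ∫⁻ x, ENNReal.ofReal t⁻¹ * ENNReal.ofReal (u x ^ 2 * (1 - e b t x)) ∂ν :=
            lintegral_mono hle
        _ ≤ ENNReal.ofReal t⁻¹ * ENNReal.ofReal (2 * t * ν.real univ) := by
            rw [lintegral_const_mul' _ _ ENNReal.ofReal_ne_top]
            gcongr
        _ = 2 * ν univ := by
            rw [← ENNReal.ofReal_mul (by positivity),
              show t⁻¹ * (2 * t * ν.real univ) = 2 * ν.real univ by field_simp,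
              ENNReal.ofReal_mul (by norm_num), measureReal_def,
              ENNReal.ofReal_toReal (measure_ne_top _ _)]
            simp
    have ht : Tendsto (fun m : ℕ => 1 / ((m : ℝ) + 1) * (1 / 2)) atTop (𝓝 0) := by
      simpa using (tendsto_one_div_add_atTop_nhds_zero_nat (𝕜 := ℝ)).mul_const (1 / 2 : ℝ)
    have hfinal : ∫⁻ x, ENNReal.ofReal (u x ^ 2) * b x ∂ν = ∫⁻ x, liminf (fun m : ℕ =>
        ENNReal.ofReal (u x ^ 2 * ((b x).toReal /
          (1 + 1 / ((m : ℝ) + 1) * (1 / 2) * (b x).toReal)))) atTop ∂ν := by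
      refine lintegral_congr_ae ?_
      filter_upwards [hfin b hb] with x hx
      rw [← ENNReal.ofReal_toReal hx.ne, ← ENNReal.ofReal_mul (sq_nonneg _),
        ENNReal.ofReal_toReal hx.ne]
      refine (Tendsto.liminf_eq ((ENNReal.continuous_ofReal.tendsto _).comp
        (Tendsto.const_mul _ ?_))).symm
      have h1 : Tendsto (fun m : ℕ => 1 + 1 / ((m : ℝ) + 1) * (1 / 2) * (b x).toReal) atTop
          (𝓝 1) := by
        simpa using (ht.mul_const (b x).toReal).const_add 1
      have h2 := (tendsto_const_nhds (x := (b x).toReal)).div h1 one_ne_zero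
      rw [div_one] at h2
      exact h2
    rw [hfinal]
    refine (lintegral_liminf_le fun m => by fun_prop).trans ?_
    refine (liminf_le_liminf (v := fun _ => 2 * ν univ) (Eventually.of_forall fun m =>
      hpass _ (by positivity) ?_)).trans (by simp)
    have : 1 / ((m : ℝ) + 1) ≤ 1 := by
      rw [div_le_one (by positivity)]
      have : (0 : ℝ) ≤ m := by positivity
      linarith
    linarith

end Factorization

/-! ### Bessel potentials, capacity and duality -/

section Potential

variable {N : ℕ} {α s q : ℝ}

/-- The Bessel potential `G_α * F` of a function with values in `[0, ∞]`. -/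
noncomputable def ePotential (α : ℝ) (F : EuclideanSpace ℝ (Fin N) → ℝ≥0∞)
    (x : EuclideanSpace ℝ (Fin N)) : ℝ≥0∞ :=
  ∫⁻ y, besselKernel N α (x - y) * F y

theorem measurable_besselKernel : Measurable (besselKernel N α) := by
  unfold besselKernel
  refine Measurable.const_mul (Measurable.lintegral_prod_right'
    (f := fun p : EuclideanSpace ℝ (Fin N) × ℝ => ENNReal.ofReal
      (p.2 ^ (α / 2 - 1) * Real.exp (-p.2) * ((4 * Real.pi * p.2) ^ (-(N : ℝ) / 2) *
        Real.exp (-‖p.1‖ ^ 2 / (4 * p.2))))) ?_) _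
  fun_prop

theorem measurable_besselKernel_sub (x : EuclideanSpace ℝ (Fin N)) :
    Measurable fun y => besselKernel N α (x - y) :=
  measurable_besselKernel.comp (measurable_const.sub measurable_id)

variable {F : EuclideanSpace ℝ (Fin N) → ℝ≥0∞}

theorem measurable_ePotential (hF : Measurable F) : Measurable (ePotential α F) := by
  refine Measurable.lintegral_prod_right'
    (f := fun p : EuclideanSpace ℝ (Fin N) × EuclideanSpace ℝ (Fin N) =>
      besselKernel N α (p.1 - p.2) * F p.2) ?_
  exact (measurable_besselKernel.comp (measurable_fst.sub measurable_snd)).mul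
    (hF.comp measurable_snd)

theorem ePotential_congr_ae {G : EuclideanSpace ℝ (Fin N) → ℝ≥0∞} (h : F =ᵐ[volume] G)
    (x : EuclideanSpace ℝ (Fin N)) : ePotential α F x = ePotential α G x :=
  lintegral_congr_ae (by filter_upwards [h] with y hy; rw [hy])

theorem ePotential_const_mul {c : ℝ≥0∞} (hc : c ≠ ∞) (x : EuclideanSpace ℝ (Fin N)) :
    ePotential α (fun y => c * F y) x = c * ePotential α F x := by
  simp only [ePotential]
  rw [← lintegral_const_mul' _ _ hc]
  simp only [mul_left_comm]

theorem ePotential_add (hF : Measurable F) {G : EuclideanSpace ℝ (Fin N) → ℝ≥0∞}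
    (x : EuclideanSpace ℝ (Fin N)) :
    ePotential α (fun y => F y + G y) x = ePotential α F x + ePotential α G x := by
  simp only [ePotential, mul_add]
  exact lintegral_add_left ((measurable_besselKernel_sub x).mul hF) _

theorem ePotential_mono {G : EuclideanSpace ℝ (Fin N) → ℝ≥0∞} (h : ∀ y, F y ≤ G y)
    (x : EuclideanSpace ℝ (Fin N)) : ePotential α F x ≤ ePotential α G x :=
  lintegral_mono fun y => mul_le_mul_right (h y) _

/-- The infinity set of the potential of a function in the Lorentz space has capacity zero: all
multiples of the function are admissible. -/
theorem besselLorentzCapacity_eq_zero (hq : 1 ≤ q) (hF : Measurable F)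
    (hL : eLorentz s q volume F < ∞) {E : Set (EuclideanSpace ℝ (Fin N))}
    (hE : ∀ x ∈ E, ePotential α F x = ∞) : besselLorentzCapacity α s q E = 0 := by
  have hfin := ae_lt_top_of_eLorentz hq hL
  have key : ∀ n : ℕ, besselLorentzCapacity α s q E ≤
      ((n + 1 : ℕ) : ℝ≥0∞)⁻¹ * eLorentz s q volume F := by
    intro n
    set c : ℝ≥0∞ := ((n + 1 : ℕ) : ℝ≥0∞)⁻¹
    have hc : c ≠ 0 := by simp [c, -Nat.cast_add]
    have hc' : c ≠ ∞ := by simp [c]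
    have hae : (fun y => ENNReal.ofReal (c * F y).toReal) =ᵐ[volume] fun y => c * F y := by
      filter_upwards [hfin] with y hy
      exact ENNReal.ofReal_toReal (ENNReal.mul_ne_top hc' hy.ne)
    have hn : lorentzNorm s q volume (fun y => (c * F y).toReal) =
        eLorentz s q volume (fun y => c * F y) := by
      rw [lorentzNorm_eq_eLorentz]
      refine eLorentz_congr_ae ?_
      filter_upwards [hae] with y hy
      rw [Real.enorm_of_nonneg ENNReal.toReal_nonneg]
      exact hy
    have hle := eLorentz_const_mul_le (ν := volume) (F := F) (s := s) hq hc hc'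
    refine le_trans (sInf_le ?_) (hn.le.trans hle)
    refine ⟨fun y => (c * F y).toReal, ⟨?_, ?_⟩, fun y => ENNReal.toReal_nonneg,
      fun x hx => ?_, rfl⟩
    · exact (hF.const_mul c).ennreal_toReal.aestronglyMeasurable
    · rw [hn]
      exact hle.trans_lt (ENNReal.mul_lt_top hc'.lt_top hL)
    · have h := ePotential_congr_ae (α := α) hae x
      rw [ePotential_const_mul hc', hE x hx, ENNReal.mul_top hc] at h
      exact le_top.trans h.ge
  have hlim : Tendsto (fun n : ℕ => ((n + 1 : ℕ) : ℝ≥0∞)⁻¹ * eLorentz s q volume F) atTop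
      (𝓝 (0 * eLorentz s q volume F)) :=
    ENNReal.Tendsto.mul_const
      ((tendsto_add_atTop_iff_nat 1).2 ENNReal.tendsto_inv_nat_nhds_zero) (Or.inr hL.ne)
  rw [zero_mul] at hlim
  exact le_antisymm (ge_of_tendsto' hlim key) (zero_le)

/-- For a finite measure that does not charge sets of zero capacity, the potentials of the unit
ball are bounded in measure: otherwise a convergent series of potentials would be infinite on a set
of positive measure. -/
theorem bounded_in_measure_ePotential (hq : 1 ≤ q) {Ω : Set (EuclideanSpace ℝ (Fin N))}
    {ν : Measure Ω} [IsFiniteMeasure ν] (hν : AbsolutelyContinuousCapacity α s q ν)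
    {ε : ℝ≥0∞} (hε : 0 < ε) :
    ∃ l : ℝ, ∀ F : EuclideanSpace ℝ (Fin N) → ℝ≥0∞, Measurable F → eLorentz s q volume F ≤ 1 →
      ν {x | ENNReal.ofReal l < ePotential α F x} ≤ ε := by
  by_contra! hc
  choose F hFm hFL hFε using fun n : ℕ => hc (4 ^ n)
  let S : EuclideanSpace ℝ (Fin N) → ℝ≥0∞ := fun y => ∑' n, 2⁻¹ ^ n * F n y
  have hSm : Measurable S := Measurable.tsum fun n => (hFm n).const_mul _
  have h2 : ∀ n : ℕ, (2⁻¹ : ℝ≥0∞) ^ n ≠ 0 := fun n => by simp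
  have h2' : ∀ n : ℕ, (2⁻¹ : ℝ≥0∞) ^ n ≠ ∞ := fun n => ENNReal.pow_ne_top (by simp)
  have hSL : eLorentz s q volume S < ∞ := by
    calc eLorentz s q volume S
        ≤ ∑' n, eLorentz s q volume (fun y => 2⁻¹ ^ n * F n y) :=
          eLorentz_tsum_le hq fun n => ((hFm n).const_mul _).aemeasurable
      _ ≤ ∑' n, (2⁻¹ : ℝ≥0∞) ^ n := by
          refine ENNReal.tsum_le_tsum fun n => (eLorentz_const_mul_le hq (h2 n) (h2' n)).trans ?_
          exact (mul_le_mul_right (hFL n) _).trans (mul_one _).le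
      _ < ∞ := by rw [ENNReal.tsum_geometric, ENNReal.one_sub_inv_two, inv_inv]; simp
  let A : ℕ → Set Ω := fun n => {x | ENNReal.ofReal (4 ^ n) < ePotential α (F n) x}
  have hA : ∀ n, MeasurableSet (A n) := fun n =>
    measurableSet_lt measurable_const ((measurable_ePotential (hFm n)).comp measurable_subtype_coe)
  let B : ℕ → Set Ω := fun m => ⋃ n ≥ m, A n
  have hB : ∀ m, MeasurableSet (B m) := fun m =>
    MeasurableSet.iUnion fun n => MeasurableSet.iUnion fun _ => hA n
  have hBanti : Antitone B := fun a b hab =>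
    biUnion_subset_biUnion_left fun n (hn : b ≤ n) => le_trans hab hn
  have hcap : besselLorentzCapacity α s q (Subtype.val '' ⋂ m, B m) = 0 := by
    refine besselLorentzCapacity_eq_zero hq hSm hSL ?_
    rintro _ ⟨x, hx, rfl⟩
    refine ENNReal.eq_top_of_forall_nnreal_le fun r => ?_
    obtain ⟨m, hm⟩ := pow_unbounded_of_one_lt r (one_lt_two (α := ℝ≥0))
    obtain ⟨n, hn, hxn⟩ := mem_iUnion₂.1 (mem_iInter.1 hx m)
    have hxn' : ENNReal.ofReal (4 ^ n) < ePotential α (F n) x := hxn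
    calc (r : ℝ≥0∞) ≤ 2 ^ m := by exact_mod_cast hm.le
      _ ≤ 2 ^ n := pow_le_pow_right₀ (by norm_num) hn
      _ = 2⁻¹ ^ n * ENNReal.ofReal (4 ^ n) := by
          rw [ENNReal.ofReal_pow (by norm_num), ← mul_pow,
            show ENNReal.ofReal 4 = 2 * 2 by norm_num, ← mul_assoc,
            ENNReal.inv_mul_cancel (by norm_num) (by norm_num), one_mul]
      _ ≤ 2⁻¹ ^ n * ePotential α (F n) x := by gcongr
      _ = ePotential α (fun y => 2⁻¹ ^ n * F n y) x := (ePotential_const_mul (h2' n) _).symm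
      _ ≤ ePotential α S x :=
          ePotential_mono (fun y => ENNReal.le_tsum (f := fun n => 2⁻¹ ^ n * F n y) n) _
  have h0 := hν _ (MeasurableSet.iInter hB) hcap
  rw [hBanti.measure_iInter (fun m => (hB m).nullMeasurableSet) ⟨0, measure_ne_top _ _⟩] at h0
  refine absurd (le_iInf fun m => ?_) (not_le.2 (h0.trans_lt hε))
  exact (hFε m).le.trans (measure_mono (subset_iUnion₂_of_subset m le_rfl le_rfl))

/-- Homogeneity extends a bound on the unit ball to all functions. Dividing by `‖F‖ + 1 / (n + 1)`
avoids a separate treatment of norm zero. -/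
theorem lintegral_ePotential_le (hq : 1 ≤ q) {σ : Measure (EuclideanSpace ℝ (Fin N))}
    {M : ℝ≥0∞} (hM : M ≠ ∞)
    (h : ∀ F : EuclideanSpace ℝ (Fin N) → ℝ≥0∞, Measurable F → eLorentz s q volume F ≤ 1 →
      ∫⁻ x, ePotential α F x ∂σ ≤ M)
    (hF : Measurable F) (hL : eLorentz s q volume F < ∞) :
    ∫⁻ x, ePotential α F x ∂σ ≤ M * eLorentz s q volume F := by
  have key : ∀ n : ℕ, ∫⁻ x, ePotential α F x ∂σ ≤
      M * (eLorentz s q volume F + ((n + 1 : ℕ) : ℝ≥0∞)⁻¹) := by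
    intro n
    set c : ℝ≥0∞ := eLorentz s q volume F + ((n + 1 : ℕ) : ℝ≥0∞)⁻¹
    have hc : c ≠ 0 := by simp [c, -Nat.cast_add]
    have hc' : c ≠ ∞ := by simp [c, hL.ne]
    have h1 := h (fun y => c⁻¹ * F y) (hF.const_mul _) ((eLorentz_const_mul_le hq (by simp [hc'])
      (by simp [hc])).trans (by
        rw [← ENNReal.inv_mul_cancel hc hc']
        gcongr
        exact le_self_add))
    simp only [ePotential_const_mul (ENNReal.inv_ne_top.2 hc)] at h1
    rw [lintegral_const_mul' _ _ (ENNReal.inv_ne_top.2 hc), mul_comm, ← div_eq_mul_inv,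
      ENNReal.div_le_iff hc hc'] at h1
    exact h1
  have hlim : Tendsto (fun n : ℕ => M * (eLorentz s q volume F + ((n + 1 : ℕ) : ℝ≥0∞)⁻¹)) atTop
      (𝓝 (M * (eLorentz s q volume F + 0))) :=
    ENNReal.Tendsto.const_mul (tendsto_const_nhds.add
      ((tendsto_add_atTop_iff_nat 1).2 ENNReal.tendsto_inv_nat_nhds_zero)) (Or.inr hM)
  rw [add_zero] at hlim
  exact ge_of_tendsto' hlim key

/-- A measure against which the potentials of nonnegative functions of the unit ball have bounded
integrals belongs to the dual of the Bessel–Lorentz space. -/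
theorem memBesselLorentzDual_of_lintegral_le (hq : 1 ≤ q)
    {σ : Measure (EuclideanSpace ℝ (Fin N))} {M : ℝ≥0∞} (hM : M ≠ ∞)
    (h : ∀ F : EuclideanSpace ℝ (Fin N) → ℝ≥0∞, Measurable F → eLorentz s q volume F ≤ 1 →
      ∫⁻ x, ePotential α F x ∂σ ≤ M) : MemBesselLorentzDual α s q σ := by
  refine ⟨M.toReal, fun f hf => ?_⟩
  let f' := hf.1.mk f
  have hf'm : StronglyMeasurable f' := hf.1.stronglyMeasurable_mk
  have hff' : f =ᵐ[volume] f' := hf.1.ae_eq_mk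
  let F : EuclideanSpace ℝ (Fin N) → ℝ≥0∞ := fun y => ‖f' y‖ₑ
  have hFm : Measurable F := hf'm.measurable.enorm
  have hfF : (fun y => ‖f y‖ₑ) =ᵐ[volume] F := by
    filter_upwards [hff'] with y hy
    simp only [F, hy]
  have hL : lorentzNorm s q volume f = eLorentz s q volume F := eLorentz_congr_ae hfF
  have hLfin : eLorentz s q volume F < ∞ := hL ▸ hf.2
  have hI := lintegral_ePotential_le hq hM h hFm hLfin
  have hIfin : ∫⁻ x, ePotential α F x ∂σ < ∞ := hI.trans_lt (ENNReal.mul_lt_top hM.lt_top hLfin)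
  have hbound : ∀ x, ∫⁻ y, ‖(besselKernel N α (x - y)).toReal * f y‖ₑ ≤ ePotential α F x := by
    intro x
    rw [← ePotential_congr_ae hfF]
    refine lintegral_mono fun y => ?_
    rw [enorm_mul, Real.enorm_of_nonneg ENNReal.toReal_nonneg]
    exact mul_le_mul_left ENNReal.ofReal_toReal_le _
  have hb : ∀ x, ‖besselPotential α f x‖ₑ ≤ ePotential α F x := fun x =>
    (enorm_integral_le_lintegral_enorm _).trans (hbound x)
  have hmeas : StronglyMeasurable (besselPotential α f) := by
    have : besselPotential α f = fun x => ∫ y, (besselKernel N α (x - y)).toReal * f' y := by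
      ext x
      exact integral_congr_ae (by filter_upwards [hff'] with y hy; rw [hy])
    rw [this]
    refine StronglyMeasurable.integral_prod_right'
      (f := fun p : EuclideanSpace ℝ (Fin N) × EuclideanSpace ℝ (Fin N) =>
        (besselKernel N α (p.1 - p.2)).toReal * f' p.2) ?_
    exact ((measurable_besselKernel.comp
      (measurable_fst.sub measurable_snd)).ennreal_toReal.mul
      (hf'm.measurable.comp measurable_snd)).stronglyMeasurable
  refine ⟨?_, ⟨hmeas.aestronglyMeasurable, (lintegral_mono hb).trans_lt hIfin⟩, ?_⟩
  · filter_upwards [ae_lt_top (measurable_ePotential hFm) hIfin.ne] with x hx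
    exact ⟨(measurable_besselKernel_sub x).ennreal_toReal.aestronglyMeasurable.mul hf.1,
      (hbound x).trans_lt hx⟩
  · rw [hL, ← ENNReal.toReal_mul, ← Real.norm_eq_abs, ← toReal_enorm]
    refine ENNReal.toReal_mono (ENNReal.mul_ne_top hM hLfin.ne) ?_
    exact (enorm_integral_le_lintegral_enorm _).trans ((lintegral_mono hb).trans hI)

/-- A finite measure that does not charge sets of zero capacity has an almost everywhere positive
weight that integrates the potentials of the unit ball to a bounded amount. -/
theorem exists_weight_ePotential (hq : 1 ≤ q) {Ω : Set (EuclideanSpace ℝ (Fin N))}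
    {ν : Measure Ω} [IsFiniteMeasure ν] (hν : AbsolutelyContinuousCapacity α s q ν) :
    ∃ g : Ω → ℝ≥0∞, Measurable g ∧ (∀ᵐ x ∂ν, 0 < g x) ∧
      ∀ F : EuclideanSpace ℝ (Fin N) → ℝ≥0∞, Measurable F → eLorentz s q volume F ≤ 1 →
        ∫⁻ x, g x * ePotential α F x ∂ν ≤ 2 * ν univ := by
  let T : Set (Ω → ℝ≥0∞) := {k | ∃ F : EuclideanSpace ℝ (Fin N) → ℝ≥0∞, Measurable F ∧
    eLorentz s q volume F ≤ 1 ∧ k = fun x : Ω => ePotential α F x}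
  have hmeas : ∀ k ∈ T, Measurable k := by
    rintro _ ⟨F, hF, -, rfl⟩
    exact (measurable_ePotential hF).comp measurable_subtype_coe
  have hconv : ∀ k ∈ T, ∀ k' ∈ T, ∀ t : ℝ, 0 < t → t < 1 →
      (fun x => ENNReal.ofReal (1 - t) * k x + ENNReal.ofReal t * k' x) ∈ T := by
    rintro _ ⟨F, hF, hFL, rfl⟩ _ ⟨G, hG, hGL, rfl⟩ t ht0 ht1
    have h1 : ENNReal.ofReal (1 - t) ≠ 0 := by simpa using ht1
    have h2 : ENNReal.ofReal t ≠ 0 := by simpa using ht0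
    refine ⟨fun y => ENNReal.ofReal (1 - t) * F y + ENNReal.ofReal t * G y,
      (hF.const_mul _).add (hG.const_mul _), ?_, ?_⟩
    · refine (eLorentz_add_le hq (hF.const_mul _).aemeasurable (hG.const_mul _).aemeasurable).trans
        ((add_le_add (eLorentz_const_mul_le hq h1 ENNReal.ofReal_ne_top)
          (eLorentz_const_mul_le hq h2 ENNReal.ofReal_ne_top)).trans ?_)
      calc _ ≤ ENNReal.ofReal (1 - t) * 1 + ENNReal.ofReal t * 1 := by gcongr
        _ = 1 := by
          rw [mul_one, mul_one, ← ENNReal.ofReal_add (by linarith) ht0.le]; simp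
    · ext x
      rw [ePotential_add (hF.const_mul _), ePotential_const_mul ENNReal.ofReal_ne_top,
        ePotential_const_mul ENNReal.ofReal_ne_top]
  obtain ⟨g, hg, hpos, hb⟩ := exists_weight_of_bounded_in_probability (ν := ν) (T := T)
    ⟨_, fun _ => 0, measurable_const, (eLorentz_zero hq).trans_le zero_le, rfl⟩ hmeas hconv
    fun ε hε => by
      obtain ⟨l, hl⟩ := bounded_in_measure_ePotential hq hν hε
      exact ⟨l, by rintro _ ⟨F, hF, hFL, rfl⟩; exact hl F hF hFL⟩
  exact ⟨g, hg, hpos, fun F hF hL => hb _ ⟨F, hF, hL, rfl⟩⟩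

end Potential

/-! ### Approximation by measures in the dual -/


/-- Integrals against densities `wₙ ≤ 1` that are eventually equal to `1` almost everywhere
converge to the full integral. -/
theorem tendsto_integral_withDensity {X : Type*} [MeasurableSpace X] {μ : Measure X}
    {w : ℕ → X → ℝ≥0∞} (hw : ∀ n, Measurable (w n)) (hw1 : ∀ n x, w n x ≤ 1)
    (hlim : ∀ᵐ x ∂μ, ∀ᶠ n in atTop, w n x = 1) {φ : X → ℝ} (hφ : Integrable φ μ) :
    Tendsto (fun n => ∫ x, φ x ∂(μ.withDensity (w n))) atTop (𝓝 (∫ x, φ x ∂μ)) := by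
  have hlt : ∀ n x, w n x < ∞ := fun n x => (hw1 n x).trans_lt ENNReal.one_lt_top
  have hI : ∀ n, ∫ x, φ x ∂(μ.withDensity (w n)) = ∫ x, (w n x).toReal • φ x ∂μ := fun n =>
    integral_withDensity_eq_integral_toReal_smul (hw n) (Eventually.of_forall (hlt n)) φ
  simp only [hI]
  refine tendsto_integral_of_dominated_convergence (fun x => ‖φ x‖)
    (fun n => (hw n).ennreal_toReal.aestronglyMeasurable.smul hφ.1) hφ.norm
    (fun n => Eventually.of_forall fun x => ?_) ?_
  · rw [norm_smul, Real.norm_of_nonneg ENNReal.toReal_nonneg]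
    exact mul_le_of_le_one_left (norm_nonneg _)
      (by simpa using ENNReal.toReal_mono ENNReal.one_ne_top (hw1 n x))
  · filter_upwards [hlim] with x hx
    refine tendsto_const_nhds.congr' ?_
    filter_upwards [hx] with n hn
    simp [hn]

theorem theoremt (N : ℕ) (hN : 1 ≤ N) (Ω : Set (EuclideanSpace ℝ (Fin N))) (hΩ : IsOpen Ω)
    (α s q : ℝ) (hα : 0 < α) (hs : 1 < s) (hq : 1 ≤ q)
    (μ : Measure Ω) [IsLocallyFiniteMeasure μ]
    (hμ : AbsolutelyContinuousCapacity α s q μ) :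
    ∃ μn : ℕ → Measure Ω,
      Monotone μn ∧
      (∀ n, IsFiniteMeasure (μn n)) ∧
      (∀ n, IsCompact (μn n).support) ∧
      (∀ n, MemBesselLorentzDual α s q ((μn n).map Subtype.val)) ∧
      (∀ φ : Ω → ℝ, Continuous φ → HasCompactSupport φ →
        Tendsto (fun n => ∫ x, φ x ∂(μn n)) atTop (𝓝 (∫ x, φ x ∂μ))) ∧
      (IsFiniteMeasure μ → ∀ φ : Ω →ᵇ ℝ,
        Tendsto (fun n => ∫ x, φ x ∂(μn n)) atTop (𝓝 (∫ x, φ x ∂μ))) := by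
  have : LocallyCompactSpace Ω := hΩ.locallyCompactSpace
  -- a finite measure `h μ` with the same null sets as `μ`
  set ν := μ.toFinite
  have hνcap : AbsolutelyContinuousCapacity α s q ν := fun E hE hcap =>
    toFinite_absolutelyContinuous μ (hμ E hE hcap)
  obtain ⟨g, hg, hgpos, hgb⟩ := exists_weight_ePotential hq hνcap
  let h : Ω → ℝ≥0∞ := ν.rnDeriv μ
  have hh : Measurable h := Measure.measurable_rnDeriv ν μ
  have hνh : μ.withDensity h = ν :=
    Measure.withDensity_rnDeriv_eq ν μ (toFinite_absolutelyContinuous μ)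
  have hhpos : ∀ᵐ x ∂μ, 0 < h x := Measure.rnDeriv_pos' (absolutelyContinuous_toFinite μ)
  have hgpos' : ∀ᵐ x ∂μ, 0 < g x := absolutelyContinuous_toFinite μ hgpos
  let K : CompactExhaustion Ω := default
  have hK : ∀ n, MeasurableSet (K n) := fun n => (K.isCompact n).measurableSet
  let v : ℕ → Ω → ℝ≥0∞ := fun n x => min 1 (n * (h x * g x))
  have hv : ∀ n, Measurable (v n) := fun n => measurable_const.min ((hh.mul hg).const_mul _)
  let w : ℕ → Ω → ℝ≥0∞ := fun n => (K n).indicator (v n)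
  have hw : ∀ n, Measurable (w n) := fun n => (hv n).indicator (hK n)
  have hwv : ∀ n x, w n x ≤ v n x := fun n x => indicator_le_self _ _ x
  have hw1 : ∀ n x, w n x ≤ 1 := fun n x => (hwv n x).trans (min_le_left _ _)
  have hlim : ∀ᵐ x ∂μ, ∀ᶠ n in atTop, w n x = 1 := by
    filter_upwards [hhpos, hgpos'] with x hx hx'
    have hne : h x * g x ≠ 0 := mul_ne_zero hx.ne' hx'.ne'
    obtain ⟨m, hm⟩ := ENNReal.exists_nat_mul_gt hne ENNReal.one_ne_top
    filter_upwards [eventually_ge_atTop m, eventually_ge_atTop (K.find x)] with n hn hn'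
    have hxK : x ∈ K n := K.subset hn' (K.mem_find x)
    simp only [w, v, indicator_of_mem hxK]
    refine min_eq_left (hm.le.trans ?_)
    gcongr
  have hfin : ∀ n, IsFiniteMeasure (μ.withDensity (w n)) := by
    intro n
    refine isFiniteMeasure_withDensity (ne_of_lt ?_)
    calc ∫⁻ x, w n x ∂μ ≤ ∫⁻ x, (K n).indicator 1 x ∂μ := by
          refine lintegral_mono fun x => ?_
          by_cases hx : x ∈ K n <;> simp [w, v, hx]
      _ = μ (K n) := lintegral_indicator_one (hK n)
      _ < ∞ := (K.isCompact n).measure_lt_top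
  refine ⟨fun n => μ.withDensity (w n), ?_, hfin, ?_, ?_, ?_, ?_⟩
  · intro a b hab
    refine withDensity_mono (Eventually.of_forall fun x => ?_)
    refine (indicator_le_indicator_of_subset (K.subset hab) (fun _ => zero_le) x).trans
      (indicator_le_indicator ?_)
    simp only [v]
    gcongr
  · intro n
    refine (K.isCompact n).of_isClosed_subset Measure.isClosed_support
      (Measure.support_subset_of_isClosed (K.isCompact n).isClosed ?_)
    rw [mem_ae_iff, withDensity_apply _ (hK n).compl,
      setLIntegral_congr_fun (g := fun _ => 0) (hK n).compl fun x hx => indicator_of_notMem hx _]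
    simp
  · intro n
    refine memBesselLorentzDual_of_lintegral_le (M := n * (2 * ν univ)) hq
      (ENNReal.mul_ne_top (by simp) (ENNReal.mul_ne_top (by simp) (measure_ne_top _ _)))
      fun F hF hL => ?_
    have hP : Measurable fun x : Ω => ePotential α F x :=
      (measurable_ePotential hF).comp measurable_subtype_coe
    rw [lintegral_map (measurable_ePotential hF) measurable_subtype_coe,
      lintegral_withDensity_eq_lintegral_mul _ (hw n) hP]
    calc _ ≤ ∫⁻ x, n * (h x * (g x * ePotential α F x)) ∂μ := by
          refine lintegral_mono fun x => ?_
          refine (mul_le_mul_left ((hwv n x).trans (min_le_right _ _)) _).trans (le_of_eq ?_)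
          ring
      _ = n * ∫⁻ x, g x * ePotential α F x ∂ν := by
          rw [lintegral_const_mul' _ _ (by simp), ← hνh,
            lintegral_withDensity_eq_lintegral_mul _ hh
              (g := fun x => g x * ePotential α F x) (hg.mul hP)]
          rfl
      _ ≤ _ := by gcongr; exact hgb F hF hL
  · intro φ hφ hφc
    exact tendsto_integral_withDensity hw hw1 hlim (hφ.integrable_of_hasCompactSupport hφc)
  · intro _ φ
    exact tendsto_integral_withDensity hw hw1 hlim (φ.integrable μ)
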